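/- Let $\mathbb{F}$ be a perfect field and let $\chi$ be a non-singular projective algebraic curve over $\mathbb{F}$ that is irreducible over $\overline{\mathbb{F}}$. Let $\Upsilon\subseteq\mathbb{P}^2_{\mathbb{F}}$ be a plane model of $\chi$ with only one branch at infinity: $\Upsilon$ is an integral closed subscheme of $\mathbb{P}^2_{\mathbb{F}}$, there is a birational $\mathbb{F}$-morphism $\mathrm{n}:\chi\to\Upsilon$, and there is a line $L\subseteq\mathbb{P}^2$ defined over $\mathbb{F}$ such that $L\cap\Upsilon$ consists of only one geometric point $P$ and $\chi$ has only one branch at $P$, that is, exactly one geometric point $\overline{P}$ of $\chi$ lies over $P$. Let $\mathcal{C}=\chi\setminus\{\overline{P}\}$ and $\mathcal{Z}=\Upsilon\setminus\{P\}$, and let $A=\mathcal{O}_\chi(\mathcal{C})$ and $B=\mathcal{O}_\Upsilon(\mathcal{Z})$ be their affine coordinate $\mathbb{F}$-algebras. Put $$\Gamma_P=\{-v_{\overline{P}}(f)\mid f\in A,\ f\neq 0\},\qquad S_P=\{-v_{\overline{P}}(f)\mid f\in B,\ f\neq 0\},$$ where $v_{\overline P}$ is the order of vanishing at $\overline{P}$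 and functions on $\mathcal{Z}$ are pulled back along $\mathrm{n}$. Then $\mathrm{n}$ maps $\mathcal{C}$ to $\mathcal{Z}$, pulling back functions embeds $B$ in $A$, and $$\sharp(\Gamma_P\setminus S_P)=\dim_{\mathbb{F}}(A/B)=\sum_{Q\in\mathcal{Z}}\delta_Q(\mathcal{Z})<\infty,$$ where $Q$ ranges over all closed points of $\mathcal{Z}$ and $\delta_Q(\mathcal{Z})=\dim_{\mathbb{F}}(\overline{\mathcal{O}}_{\Upsilon,Q}/\mathcal{O}_{\Upsilon,Q})$, with $\overline{\mathcal{O}}_{\Upsilon,Q}$ the normalization of $\mathcal{O}_{\Upsilon,Q}$. -/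

import Mathlib

open AlgebraicGeometry CategoryTheory

universe u

namespace OneBranch

attribute [local instance] MvPolynomial.gradedAlgebra

noncomputable section

variable {F : Type u} [Field F]

/-- A morphism of integral schemes is birational if it sends the generic point to the generic
point and induces an isomorphism between the function fields. -/
def IsBirationalMorphism {X Y : Scheme.{u}} [IsIntegral X] [IsIntegral Y] (f : X ⟶ Y) : Prop :=
  f (genericPoint X) = genericPoint Y ∧ IsIso (f.stalkMap (genericPoint X))

variable (F) in
/-- The projective plane over `F`, as `Proj F[X₀, X₁, X₂]`. -/
abbrev Plane : Scheme.{u} := Proj (MvPolynomial.homogeneousSubmodule (Fin 3) F)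

variable (F) in
/-- The structure morphism of the projective plane. -/
def planeToBase : Plane F ⟶ Spec (.of F) :=
  Proj.toSpecZero (MvPolynomial.homogeneousSubmodule (Fin 3) F) ≫
    Spec.map (CommRingCat.ofHom
      (algebraMap F (MvPolynomial.homogeneousSubmodule (Fin 3) F 0)))

/-- The (closed) zero set in the projective plane of a form `l`. -/
def zeroSet (l : MvPolynomial (Fin 3) F) : Set (Plane F) :=
  ((Proj.basicOpen (MvPolynomial.homogeneousSubmodule (Fin 3) F) l : (Plane F).Opens) :
    Set (Plane F))ᶜ

/-- Geometric points of an `F`-scheme: its points over the algebraic closure of `F`. -/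
def GeometricPoint {X : Scheme.{u}} (s : X ⟶ Spec (.of F)) : Type u :=
  {x : Spec (.of (AlgebraicClosure F)) ⟶ X //
    x ≫ s = Spec.map (CommRingCat.ofHom (algebraMap F (AlgebraicClosure F)))}

/-- The point of the scheme underlying a geometric point. -/
def GeometricPoint.point {X : Scheme.{u}} {s : X ⟶ Spec (.of F)} (x : GeometricPoint s) : X :=
  x.1 (IsLocalRing.closedPoint (AlgebraicClosure F))

/-- The structure map from `F` to the ring of sections of an `F`-scheme over an open set. -/
def baseToSections {X : Scheme.{u}} (s : X ⟶ Spec (.of F)) (U : X.Opens) : F →+* Γ(X, U) :=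
  ((Scheme.ΓSpecIso (.of F)).inv ≫ s.appLE ⊤ U le_top).hom

/-- The structure map from `F` to the local ring of an `F`-scheme at a point. -/
def baseToStalk {X : Scheme.{u}} (s : X ⟶ Spec (.of F)) (x : X) : F →+* X.presheaf.stalk x :=
  (X.presheaf.germ ⊤ x trivial).hom.comp (baseToSections s ⊤)

/-- For a homomorphism `φ : R → S` of `F`-algebras, where `i : F → R` is the structure map:
the dimension over `F` of the quotient `S / φ(R)`. -/
def quotientDim {R S : Type u} [CommRing R] [CommRing S] (i : F →+* R) (φ : R →+* S) :
    Cardinal.{u} :=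
  letI : Algebra R S := φ.toAlgebra
  letI : Module F (S ⧸ LinearMap.range (Algebra.linearMap R S)) := Module.compHom _ i
  Module.rank F (S ⧸ LinearMap.range (Algebra.linearMap R S))

/-- The invariant `δ` of an integral `F`-scheme at a point `x`: the dimension over `F` of the
quotient of the normalization of the local ring at `x` by that local ring. -/
def delta {X : Scheme.{u}} [IsIntegral X] (s : X ⟶ Spec (.of F)) (x : X) : Cardinal.{u} :=
  quotientDim (baseToStalk s x)
    (algebraMap (X.presheaf.stalk x) (integralClosure (X.presheaf.stalk x) X.functionField))

/-- The set of pole orders `-v_x(f)` at the point `x` of the non-zero functions `f` on `U` that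
belong to `T`. -/
def poleOrders {X : Scheme.{u}} [IsIntegral X] (s : X ⟶ Spec (.of F)) [LocallyOfFiniteType s]
    (x : X) (U : X.Opens) (T : Set Γ(X, U)) : Set ℤ :=
  haveI : IsLocallyNoetherian X := LocallyOfFiniteType.isLocallyNoetherian s
  {m | ∃ _ : Nonempty U, ∃ f ∈ T, f ≠ 0 ∧ m = -Scheme.ord (X.germToFunctionField U f) x}

end

end OneBranch

/-! The dimension of `A / B` is computed in two independent ways.

Globally, the pole order at the point over `P` is a degree function on `A`. It is non-negative: a
function on the complement of that point which also vanishes there is a global section on a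
universally closed integral scheme, and such sections form a field, so it is zero. Leading terms are
unique up to scalars because the residue field is `F`: over a perfect field the degree of a finite
extension counts its embeddings into the algebraic closure, and there is only one geometric point
here. Hence elements of `A`, one for each degree missed by `B`, give a basis of `A / B`
(`isDegree_neg_ord`, `IsDegree.lift_rank_quotient`). This equality of cardinals needs no finiteness.

Locally, `Z` is affine as the complement of a line section, and `n` is proper with finite fibres,
hence finite. Regularity makes `A` integrally closed, so `A` is the integral closure of `B`. The
quotient `A / B` is finitely generated and killed by a common denominator, so it has finite length
over the one-dimensional ring `B`, and its dimension is finite and the sum of those of its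
localizations at maximal ideals (`rank_eq_sum_localizedRank`). Integral closure commutes with
localization, so these are the local invariants (`normalizationQuotientMap_isLocalizedModule`). -/

namespace OneBranch

/-! ### Codimension counted by degrees -/

section Degrees

variable {F A : Type*} [Field F] [AddCommGroup A] [Module F A]

/-- A degree function on a vector space: non-negative on non-zero vectors, ultrametric, and with
leading terms that are unique up to scalars. -/
structure IsDegree (F : Type*) {A : Type*} [Field F] [AddCommGroup A] [Module F A]
    (d : A → ℤ) : Prop where
  nonneg : ∀ f, f ≠ 0 → 0 ≤ d f
  smul : ∀ (c : F) f, c ≠ 0 → f ≠ 0 → d (c • f) = d f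
  add_le : ∀ f g, f ≠ 0 → g ≠ 0 → f + g ≠ 0 → d (f + g) ≤ max (d f) (d g)
  exists_lt : ∀ f g, f ≠ 0 → g ≠ 0 → d f = d g → ∃ c : F, f - c • g ≠ 0 → d (f - c • g) < d f

namespace IsDegree

variable {d : A → ℤ} (hd : IsDegree F d)
include hd

lemma neg {f : A} (hf : f ≠ 0) : d (-f) = d f := by
  simpa using hd.smul (-1) f (by simp) hf

lemma add_eq {f g : A} (hf : f ≠ 0) (hg : g ≠ 0) (hlt : d g < d f) :
    f + g ≠ 0 ∧ d (f + g) = d f := by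
  have h0 : f + g ≠ 0 := by
    intro h
    rw [eq_neg_of_add_eq_zero_left h, hd.neg hg] at hlt
    exact lt_irrefl _ hlt
  refine ⟨h0, le_antisymm ((hd.add_le f g hf hg h0).trans (max_le le_rfl hlt.le)) ?_⟩
  have := hd.add_le (f + g) (-g) h0 (neg_ne_zero.mpr hg) (by simpa using hf)
  rw [add_neg_cancel_right, hd.neg hg] at this
  rcases le_max_iff.mp this with h | h
  · exact h
  · exact absurd hlt h.not_gt

/-- The degrees of the terms are distinct, so the term of largest index dominates and nothing
cancels it. -/
lemma sum_eq {ι : Type*} [LinearOrder ι] (e : ι → ℤ) (he : StrictMono e) (a : ι → A)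
    (ha : ∀ i, a i ≠ 0) (hda : ∀ i, d (a i) = e i) (c : ι → F) (s : Finset ι)
    (hc : ∀ i ∈ s, c i ≠ 0) :
    s = ∅ ∨ (∑ i ∈ s, c i • a i ≠ 0 ∧ ∃ i ∈ s, d (∑ i ∈ s, c i • a i) = e i) := by
  induction s using Finset.induction_on_max with
  | empty => exact Or.inl rfl
  | insert m s hm ih =>
    right
    have hms : m ∉ s := fun h => lt_irrefl _ (hm m h)
    have hcm := hc m (Finset.mem_insert_self _ _)
    have hn : c m • a m ≠ 0 := smul_ne_zero hcm (ha m)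
    have hdm : d (c m • a m) = e m := by rw [hd.smul _ _ hcm (ha m), hda]
    rw [Finset.sum_insert hms]
    rcases ih fun i hi => hc i (Finset.mem_insert_of_mem hi) with rfl | ⟨h0, i, hi, hdi⟩
    · simpa using ⟨⟨hcm, ha m⟩, hdm⟩
    · obtain ⟨h1, h2⟩ := hd.add_eq hn h0 (by rw [hdi, hdm]; exact he (hm i hi))
      exact ⟨h1, m, Finset.mem_insert_self _ _, h2.trans hdm⟩

/-- The codimension of a subspace is the number of degrees that it misses. -/
theorem lift_rank_quotient (B : Submodule F A) :
    Cardinal.lift.{0} (Module.rank F (A ⧸ B)) = Cardinal.lift (Cardinal.mk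
      ↥({m | ∃ f : A, f ≠ 0 ∧ m = d f} \ {m | ∃ f ∈ B, f ≠ 0 ∧ m = d f})) := by
  set G := {m | ∃ f : A, f ≠ 0 ∧ m = d f} \ {m | ∃ f ∈ B, f ≠ 0 ∧ m = d f} with hG
  choose a ha hda using fun m : G => m.2.1
  -- A nontrivial relation modulo `B` would be an element of `B` whose degree is one of those that
  -- `B` misses.
  have hli : LinearIndependent F fun m : G => B.mkQ (a m) := by
    rw [linearIndependent_iff']
    intro s c hs i hi
    by_contra hci
    simp_rw [← map_smul, ← map_sum] at hs
    rw [Submodule.mkQ_apply, Submodule.Quotient.mk_eq_zero] at hs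
    classical
    rw [← Finset.sum_filter_of_ne (p := fun i => c i ≠ 0) (by
      intro x _ hx hx'; exact hx (by rw [hx', zero_smul]))] at hs
    rcases hd.sum_eq (fun m : G => (m : ℤ)) (fun _ _ h => h) a ha (fun m => (hda m).symm) c
      (s.filter fun i => c i ≠ 0) (by simp) with h | ⟨h, j, -, hj⟩
    · exact Finset.notMem_empty i (h ▸ Finset.mem_filter.mpr ⟨hi, hci⟩)
    · exact j.2.2 ⟨_, hs, h, hj.symm⟩
  -- Descent on the degree: subtract a multiple of an element of `B` or of a chosen `a m` with the
  -- same degree. The guard `f ≠ 0` is there because `d 0` is arbitrary.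
  have hspan : ∀ (n : ℕ) (f : A), (f ≠ 0 → d f < n) →
      B.mkQ f ∈ Submodule.span F (Set.range fun m : G => B.mkQ (a m)) := by
    intro n
    induction n with
    | zero =>
      intro f hf
      have : f = 0 := by
        by_contra h
        exact absurd (hf h) (by simpa using hd.nonneg f h)
      simp [this]
    | succ n ih =>
      intro f hf
      by_cases hf0 : f = 0
      · simp [hf0]
      have key : ∀ g, g ≠ 0 → d f = d g →
          B.mkQ g ∈ Submodule.span F (Set.range fun m : G => B.mkQ (a m)) →
          B.mkQ f ∈ Submodule.span F (Set.range fun m : G => B.mkQ (a m)) := by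
        intro g hg hfg hgm
        obtain ⟨c, hc⟩ := hd.exists_lt f g hf0 hg hfg
        have h1 := ih (f - c • g) fun h => (hc h).trans_le (by have := hf hf0; push_cast at this; lia)
        have h2 := Submodule.add_mem _ h1 (Submodule.smul_mem _ c hgm)
        rwa [← map_smul, ← map_add, sub_add_cancel] at h2
      by_cases hB : ∃ g ∈ B, g ≠ 0 ∧ d f = d g
      · obtain ⟨g, hgB, hg0, hg⟩ := hB
        refine key g hg0 hg ?_
        rw [Submodule.mkQ_apply, (Submodule.Quotient.mk_eq_zero B).mpr hgB]
        exact zero_mem _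
      · have hm : d f ∈ G := ⟨⟨f, hf0, rfl⟩, hB⟩
        exact key (a ⟨_, hm⟩) (ha _) (hda ⟨_, hm⟩)
          (Submodule.subset_span ⟨⟨_, hm⟩, rfl⟩)
  let b := Module.Basis.mk hli (by
    rintro x -
    obtain ⟨f, rfl⟩ := B.mkQ_surjective x
    exact hspan (d f).toNat.succ f fun _ => by have := Int.self_le_toNat (d f); push_cast; lia)
  exact b.mk_eq_rank.symm

end IsDegree

end Degrees

end OneBranch

namespace OneBranch

/-! ### Modules of finite length over a finitely generated algebra -/

section FiniteLength

variable (F : Type u) {B : Type u} [Field F] [CommRing B] [Algebra F B]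

/-- The dimension over `F` of the localization of a `B`-module at a prime ideal. -/
noncomputable def localizedRank (N : Type u) [AddCommGroup N] [Module B N] (p : Ideal B)
    [p.IsPrime] : Cardinal.{u} :=
  letI : Module F (LocalizedModule p.primeCompl N) := Module.compHom _ (algebraMap F B)
  Module.rank F (LocalizedModule p.primeCompl N)

lemma localizedRank_eq {N N' : Type u} [AddCommGroup N] [Module B N] [AddCommGroup N']
    [Module B N'] [Module F N'] [IsScalarTower F B N'] (p : Ideal B) [p.IsPrime]
    (g : N →ₗ[B] N') [IsLocalizedModule p.primeCompl g] :
    localizedRank F N p = Module.rank F N' := by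
  let _ : Module F (LocalizedModule p.primeCompl N) := Module.compHom _ (algebraMap F B)
  have : IsScalarTower F B (LocalizedModule p.primeCompl N) :=
    .of_algebraMap_smul fun _ _ => rfl
  exact ((IsLocalizedModule.iso p.primeCompl g).restrictScalars F).rank_eq

lemma localizedRank_of_subsingleton (N : Type u) [AddCommGroup N] [Module B N] [Subsingleton N]
    (p : Ideal B) [p.IsPrime] : localizedRank F N p = 0 := by
  have : Subsingleton (LocalizedModule p.primeCompl N) :=
    LocalizedModule.subsingleton_iff.mpr fun m => ⟨1, one_mem _, Subsingleton.elim _ _⟩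
  let _ : Module F (LocalizedModule p.primeCompl N) := Module.compHom _ (algebraMap F B)
  exact rank_subsingleton' _ _

/-- Localization is exact and rank is additive on short exact sequences. -/
lemma localizedRank_add {N : Type u} [AddCommGroup N] [Module B N] (N₁ : Submodule B N)
    (p : Ideal B) [p.IsPrime] :
    localizedRank F (N ⧸ N₁) p + localizedRank F N₁ p = localizedRank F N p := by
  have mod (X : Type u) [AddCommGroup X] [Module B X] :
      ∃ _ : Module F (LocalizedModule p.primeCompl X),
        IsScalarTower F B (LocalizedModule p.primeCompl X) :=
    let _ : Module F (LocalizedModule p.primeCompl X) := Module.compHom _ (algebraMap F B)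
    ⟨inferInstance, .of_algebraMap_smul fun _ _ => rfl⟩
  obtain ⟨_, _⟩ := mod N
  obtain ⟨_, _⟩ := mod N₁
  obtain ⟨_, _⟩ := mod (N ⧸ N₁)
  rw [localizedRank_eq F p (LocalizedModule.mkLinearMap p.primeCompl (N ⧸ N₁)),
    localizedRank_eq F p (LocalizedModule.mkLinearMap p.primeCompl N₁),
    localizedRank_eq F p (LocalizedModule.mkLinearMap p.primeCompl N)]
  let α := IsLocalizedModule.map p.primeCompl (LocalizedModule.mkLinearMap p.primeCompl N₁)
    (LocalizedModule.mkLinearMap p.primeCompl N) N₁.subtype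
  let β := IsLocalizedModule.map p.primeCompl (LocalizedModule.mkLinearMap p.primeCompl N)
    (LocalizedModule.mkLinearMap p.primeCompl (N ⧸ N₁)) N₁.mkQ
  have hα : Function.Injective α := IsLocalizedModule.map_injective _ _ _ _ N₁.injective_subtype
  have hβ : Function.Surjective β := IsLocalizedModule.map_surjective _ _ _ _ N₁.mkQ_surjective
  have hex : Function.Exact α β :=
    LocalizedModule.map_exact p.primeCompl _ _ (LinearMap.exact_subtype_mkQ N₁)
  rw [LinearMap.rank_eq_of_surjective (f := β.restrictScalars F) hβ]
  congr 1
  have hker : LinearMap.ker (β.restrictScalars F) = LinearMap.range (α.restrictScalars F) := by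
    ext x
    exact hex x
  rw [hker]
  exact (LinearEquiv.ofInjective (α.restrictScalars F) hα).rank_eq

/-- Elements outside `m` already act invertibly on the field `B ⧸ m`. -/
lemma isLocalizedModule_id_of_isMaximal (m p : Ideal B) [m.IsMaximal] [p.IsMaximal]
    (h : p = m) : IsLocalizedModule p.primeCompl (LinearMap.id : (B ⧸ m) →ₗ[B] (B ⧸ m)) := by
  subst h
  refine ⟨fun s => ?_, fun y => ⟨(y, 1), by simp⟩, fun {x y} h => ⟨1, by simpa using h⟩⟩
  let _ := Ideal.Quotient.field p
  have hs : Ideal.Quotient.mk p s ≠ 0 := by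
    rw [Ne, Ideal.Quotient.eq_zero_iff_mem]
    exact s.2
  have e (x : B ⧸ p) : (s : B) • x = Ideal.Quotient.mk p s * x := by
    rw [Algebra.smul_def]; rfl
  rw [Module.End.isUnit_iff]
  constructor
  · intro x y hxy
    simp only [Module.algebraMap_end_apply, e] at hxy
    exact mul_left_cancel₀ hs hxy
  · intro y
    refine ⟨(Ideal.Quotient.mk p s)⁻¹ * y, ?_⟩
    simp only [Module.algebraMap_end_apply, e]
    exact mul_inv_cancel_left₀ hs y

lemma sum_eq_of_eq_zero {ι : Type u} (f : ι → Cardinal.{u}) (i : ι) (h : ∀ j, j ≠ i → f j = 0) :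
    Cardinal.sum f = f i := by
  refine le_antisymm ?_ (Cardinal.le_sum f i)
  rw [← Cardinal.mk_out (f i)]
  refine Cardinal.mk_le_of_surjective (f := fun x => (⟨i, x⟩ : Σ j, (f j).out)) ?_
  rintro ⟨j, x⟩
  by_cases hj : j = i
  · subst hj
    exact ⟨x, rfl⟩
  · have : IsEmpty (f j).out := by rw [← Cardinal.mk_eq_zero_iff, Cardinal.mk_out, h j hj]
    exact this.elim x

lemma localizedRank_congr {N N' : Type u} [AddCommGroup N] [Module B N] [AddCommGroup N']
    [Module B N'] (e : N ≃ₗ[B] N') (p : Ideal B) [p.IsPrime] :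
    localizedRank F N p = localizedRank F N' p := by
  let _ : Module F (LocalizedModule p.primeCompl N') := Module.compHom _ (algebraMap F B)
  have : IsScalarTower F B (LocalizedModule p.primeCompl N') :=
    .of_algebraMap_smul fun _ _ => rfl
  have := IsLocalizedModule.of_linearEquiv_right p.primeCompl
    (LocalizedModule.mkLinearMap p.primeCompl N') e
  exact localizedRank_eq F p (LocalizedModule.mkLinearMap p.primeCompl N' ∘ₗ e.toLinearMap)

variable [Algebra.FiniteType F B]

/-- A module of finite length over a finitely generated algebra is finite-dimensional, and its
dimension is the sum of the dimensions of its localizations at the maximal ideals. -/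
theorem rank_eq_sum_localizedRank {N : Type u} [AddCommGroup N] [Module B N]
    [mod : Module F N] [IsScalarTower F B N] (hN : IsFiniteLength B N) :
    Module.rank F N < Cardinal.aleph0 ∧
      Module.rank F N = Cardinal.sum fun p : MaximalSpectrum B => localizedRank F N p.asIdeal := by
  revert mod
  induction hN with
  | of_subsingleton =>
    intro _ _
    simp [localizedRank_of_subsingleton, rank_subsingleton', Cardinal.aleph0_pos]
  | @of_simple_quotient N _ _ N₁ hs _ ih =>
    intro _ _
    specialize @ih inferInstance inferInstance
    have hadd : Module.rank F N = Module.rank F (N ⧸ N₁) + Module.rank F N₁ := by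
      rw [LinearMap.rank_eq_of_surjective (f := N₁.mkQ.restrictScalars F) N₁.mkQ_surjective]
      congr 1
      rw [show LinearMap.ker (N₁.mkQ.restrictScalars F) = N₁.restrictScalars F by ext; simp]
      rfl
    obtain ⟨m, hm, ⟨e⟩⟩ := isSimpleModule_iff_quot_maximal.mp hs
    -- Zariski's lemma: a field finitely generated as an `F`-algebra is finite over `F`.
    have hfin : Module.Finite F (B ⧸ m) := by
      let _ := Ideal.Quotient.field m
      exact finite_of_finite_type_of_isJacobsonRing F (B ⧸ m)
    have hsimple : Module.rank F (N ⧸ N₁) =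
        Cardinal.sum fun p : MaximalSpectrum B => localizedRank F (N ⧸ N₁) p.asIdeal := by
      rw [sum_eq_of_eq_zero _ ⟨m, hm⟩]
      · have := isLocalizedModule_id_of_isMaximal m m rfl
        rw [localizedRank_congr F e, localizedRank_eq F m (LinearMap.id : (B ⧸ m) →ₗ[B] (B ⧸ m)),
          (e.restrictScalars F).rank_eq]
      · intro p hp
        -- An element of `m` outside `p` kills `B ⧸ m` and becomes invertible at `p`, so the
        -- localization vanishes.
        have hne : ¬ m ≤ p.asIdeal := fun h =>
          hp (MaximalSpectrum.ext (hm.eq_of_le p.isMaximal.ne_top h).symm)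
        obtain ⟨x, hxm, hxp⟩ := Set.not_subset.mp hne
        have : Subsingleton (LocalizedModule p.asIdeal.primeCompl (N ⧸ N₁)) := by
          refine LocalizedModule.subsingleton_iff.mpr fun y => ⟨x, hxp, e.injective ?_⟩
          obtain ⟨b, hb⟩ := Ideal.Quotient.mk_surjective (e y)
          rw [map_smul, map_zero, ← hb, Algebra.smul_def]
          change Ideal.Quotient.mk m x * Ideal.Quotient.mk m b = 0
          rw [Ideal.Quotient.eq_zero_iff_mem.mpr hxm, zero_mul]
        let _ : Module F (LocalizedModule p.asIdeal.primeCompl (N ⧸ N₁)) :=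
          Module.compHom _ (algebraMap F B)
        exact rank_subsingleton' _ _
    refine ⟨?_, ?_⟩
    · rw [hadd]
      refine Cardinal.add_lt_aleph0 ?_ ih.1
      rw [(e.restrictScalars F).rank_eq]
      exact Module.rank_lt_aleph0 F _
    · rw [hadd, hsimple, ih.2, ← Cardinal.sum_add_distrib']
      simp_rw [localizedRank_add]

end FiniteLength

/-- The module is a quotient of a finite power of `B ⧸ (c)`, which has finite length because `B` has
dimension at most one. -/
lemma isFiniteLength_of_smul_eq_zero {B N : Type*} [CommRing B] [IsDomain B] [IsNoetherianRing B]
    [Ring.KrullDimLE 1 B] [AddCommGroup N] [Module B N] [Module.Finite B N] (c : B) (hc : c ≠ 0)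
    (h : ∀ x : N, c • x = 0) : IsFiniteLength B N := by
  obtain ⟨n, g, hg⟩ := Module.Finite.exists_fin (R := B) (M := N)
  have hc' := isFiniteLength_quotient_span_singleton B (mem_nonZeroDivisors_of_ne_zero hc)
  obtain ⟨_, _⟩ := isFiniteLength_iff_isNoetherian_isArtinian.mp hc'
  let φ : (Fin n → B ⧸ Ideal.span {c}) →ₗ[B] N :=
    LinearMap.lsum B (fun _ => B ⧸ Ideal.span {c}) ℕ fun i =>
      Submodule.liftQ _ (LinearMap.toSpanSingleton B N (g i)) (by
        rw [Ideal.span_le]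
        rintro _ rfl
        simpa using h (g i))
  refine IsFiniteLength.of_surjective (f := φ)
    (isFiniteLength_iff_isNoetherian_isArtinian.mpr ⟨inferInstance, inferInstance⟩) ?_
  rw [← LinearMap.range_eq_top, ← top_le_iff, ← hg, Submodule.span_le]
  rintro _ ⟨i, rfl⟩
  refine ⟨Pi.single i (Ideal.Quotient.mk _ 1), ?_⟩
  simp only [φ, LinearMap.lsum_piSingle]
  exact one_smul B (g i)

end OneBranch

/-! ### The quotient of a normalization by its ring, and its localizations -/

namespace OneBranch

/-- `quotientDim` builds its own instances; this replaces them by ambient ones with the same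
actions. -/
lemma quotientDim_eq {F R S : Type u} [Field F] [CommRing R] [CommRing S] [inst : Algebra R S]
    (i : F →+* R) (φ : R →+* S) (h : algebraMap R S = φ)
    [mod : Module F (S ⧸ LinearMap.range (Algebra.linearMap R S))]
    (hsmul : ∀ (c : F) (x : S ⧸ LinearMap.range (Algebra.linearMap R S)), c • x = i c • x) :
    quotientDim i φ = Module.rank F (S ⧸ LinearMap.range (Algebra.linearMap R S)) := by
  subst h
  have : (algebraMap R S).toAlgebra = inst := Algebra.algebra_ext _ _ fun _ => rfl
  unfold quotientDim
  rw [this]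
  have : mod = Module.compHom _ i := Module.ext' _ _ hsmul
  rw [this]

section Normalization

/-- A common denominator of finitely many module generators of `A` is a nonzero element of the
conductor. -/
lemma exists_smul_mem_range (B A K : Type*) [CommRing B] [IsDomain B] [CommRing A] [Field K]
    [Algebra B A] [Algebra A K] [Algebra B K] [IsScalarTower B A K] [IsFractionRing B K]
    [IsIntegralClosure A B K] [Module.Finite B A] :
    ∃ c : B, c ≠ 0 ∧ ∀ x : A ⧸ LinearMap.range (Algebra.linearMap B A), c • x = 0 := by
  classical
  obtain ⟨s, hs⟩ := Module.Finite.fg_top (R := B) (M := A)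
  obtain ⟨c, hc⟩ := IsLocalization.exist_integer_multiples (nonZeroDivisors B) s
    (fun a => algebraMap A K a)
  refine ⟨c, nonZeroDivisors.coe_ne_zero c, fun x => ?_⟩
  obtain ⟨a, rfl⟩ := Submodule.Quotient.mk_surjective _ x
  rw [← Submodule.Quotient.mk_smul, Submodule.Quotient.mk_eq_zero]
  have ha : a ∈ Submodule.span B (s : Set A) := hs ▸ Submodule.mem_top
  induction ha using Submodule.span_induction with
  | mem x hx =>
    obtain ⟨b, hb⟩ := hc x hx
    refine ⟨b, IsIntegralClosure.algebraMap_injective A B K ?_⟩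
    rw [Algebra.linearMap_apply, ← IsScalarTower.algebraMap_apply, hb, Algebra.smul_def,
      Algebra.smul_def, map_mul, ← IsScalarTower.algebraMap_apply]
  | zero => rw [smul_zero]; exact zero_mem _
  | add x y _ _ hx hy => rw [smul_add]; exact add_mem hx hy
  | smul b x _ hx => rw [smul_comm]; exact Submodule.smul_mem _ b hx

variable (B A K : Type*) [CommRing B] [IsDomain B] [CommRing A] [Field K] [Algebra B A]
  [Algebra A K] [Algebra B K] [IsScalarTower B A K] [IsFractionRing B K] [IsIntegralClosure A B K]
  (R : Type*) [CommRing R] [Algebra B R] [Algebra R K] [IsScalarTower B R K]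

/-- The map from the quotient of the normalization of `B` by `B` to the quotient of the
normalization of a localization of `B` by that localization. -/
noncomputable def normalizationQuotientMap :
    (A ⧸ LinearMap.range (Algebra.linearMap B A)) →ₗ[B]
      (integralClosure R K ⧸ LinearMap.range (Algebra.linearMap R (integralClosure R K))) :=
  Submodule.mapQ _ ((LinearMap.range (Algebra.linearMap R (integralClosure R K))).restrictScalars B)
    { toFun := fun a => ⟨algebraMap A K a, ((IsIntegralClosure.isIntegral_iff (A := A) (R := B)).mpr
        ⟨a, rfl⟩).tower_top⟩
      map_add' := fun a b => Subtype.ext (map_add _ _ _)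
      map_smul' := fun b a => Subtype.ext (by
        simp [Algebra.smul_def, ← IsScalarTower.algebraMap_apply]) }
    (by
      rintro _ ⟨b, rfl⟩
      refine ⟨algebraMap B R b, Subtype.ext ?_⟩
      change algebraMap R K _ = algebraMap A K (algebraMap B A b)
      rw [← IsScalarTower.algebraMap_apply, ← IsScalarTower.algebraMap_apply])

/-- An element integral over `R` becomes integral over `B` after multiplication by some `s` in `S`.
If `x - y` equals `b / s` in `K`, then `s • (x - y) = b` comes from `B`. -/
lemma normalizationQuotientMap_isLocalizedModule (S : Submonoid B) [IsLocalization S R]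
    (_ : S ≤ nonZeroDivisors B) :
    IsLocalizedModule S (normalizationQuotientMap B A K R) := by
  have hR : Function.Injective (algebraMap R K) := by
    have := IsFractionRing.isFractionRing_of_isDomain_of_isLocalization S R K
    exact IsFractionRing.injective R K
  refine ⟨fun s => ?_, fun y => ?_, fun {x y} h => ?_⟩
  · obtain ⟨u, hu⟩ := IsLocalization.map_units R s
    rw [Module.End.isUnit_iff]
    have e (x : integralClosure R K ⧸ LinearMap.range (Algebra.linearMap R (integralClosure R K))) :
        (s : B) • x = (u : R) • x := by
      rw [hu, algebraMap_smul]
    constructor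
    · intro x y hxy
      simp only [Module.algebraMap_end_apply, e] at hxy
      have := congr((↑u⁻¹ : R) • $hxy)
      simpa [smul_smul] using this
    · intro y
      refine ⟨(↑u⁻¹ : R) • y, ?_⟩
      simp only [Module.algebraMap_end_apply, e]
      simp [smul_smul]
  · obtain ⟨y, rfl⟩ := Submodule.Quotient.mk_surjective _ y
    obtain ⟨s, hs⟩ := IsIntegral.exists_multiple_integral_of_isLocalization S (y : K) y.2
    obtain ⟨a, ha⟩ := (IsIntegralClosure.isIntegral_iff (A := A)).mp hs
    refine ⟨(Submodule.Quotient.mk a, s), ?_⟩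
    change Submodule.Quotient.mk _ = Submodule.Quotient.mk _
    congr 1
    exact Subtype.ext ha.symm
  · obtain ⟨x, rfl⟩ := Submodule.Quotient.mk_surjective _ x
    obtain ⟨y, rfl⟩ := Submodule.Quotient.mk_surjective _ y
    have h' : (Submodule.Quotient.mk _ : integralClosure R K ⧸ LinearMap.range
      (Algebra.linearMap R (integralClosure R K))) = Submodule.Quotient.mk _ := h
    rw [Submodule.Quotient.eq] at h'
    obtain ⟨r, hr⟩ := h'
    obtain ⟨b, s, rfl⟩ := IsLocalization.exists_mk'_eq S r
    refine ⟨s, ?_⟩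
    rw [← sub_eq_zero, ← smul_sub, ← Submodule.Quotient.mk_sub]
    change (Submodule.Quotient.mk ((s : B) • (x - y)) : A ⧸ _) = 0
    rw [Submodule.Quotient.mk_eq_zero]
    refine ⟨b, IsIntegralClosure.algebraMap_injective A B K ?_⟩
    have h1 : algebraMap R K (IsLocalization.mk' R b s) = algebraMap A K x - algebraMap A K y :=
      congrArg Subtype.val hr
    have h2 := congrArg (algebraMap R K) (IsLocalization.mk'_spec R b s)
    rw [map_mul, h1, ← IsScalarTower.algebraMap_apply, ← IsScalarTower.algebraMap_apply] at h2
    rw [Algebra.linearMap_apply, ← IsScalarTower.algebraMap_apply, ← h2, Algebra.smul_def, map_mul,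
      ← IsScalarTower.algebraMap_apply, map_sub, mul_comm]

end Normalization

section

variable {F : Type u} [Field F] (B A K : Type u) [CommRing B] [IsDomain B] [CommRing A] [Field K]
  [Algebra B A] [Algebra A K] [Algebra B K] [IsScalarTower B A K] [IsFractionRing B K]
  [IsIntegralClosure A B K]

lemma localizedRank_eq_quotientDim [Algebra F B] (p : Ideal B) [p.IsPrime] (R : Type u)
    [CommRing R] [Algebra B R] [Algebra R K] [IsScalarTower B R K] [IsLocalization.AtPrime R p]
    (i : F →+* R) (hi : i = (algebraMap B R).comp (algebraMap F B)) :
    localizedRank F (A ⧸ LinearMap.range (Algebra.linearMap B A)) p =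
      quotientDim i (algebraMap R (integralClosure R K)) := by
  have := normalizationQuotientMap_isLocalizedModule B A K R p.primeCompl
    p.primeCompl_le_nonZeroDivisors
  let _ : Module F (integralClosure R K ⧸
    LinearMap.range (Algebra.linearMap R (integralClosure R K))) := Module.compHom _ i
  have : IsScalarTower F B (integralClosure R K ⧸
      LinearMap.range (Algebra.linearMap R (integralClosure R K))) :=
    .of_algebraMap_smul fun c x => by
      change _ = i c • x
      rw [hi, RingHom.comp_apply]
      exact (algebraMap_smul R (algebraMap F B c) x).symm
  rw [localizedRank_eq F p (normalizationQuotientMap B A K R), quotientDim_eq i _ rfl]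
  exact fun _ _ => rfl

/-- The codimension of a curve's coordinate ring in its normalization is the sum of the local
codimensions. -/
theorem quotientDim_eq_sum [Ring.KrullDimLE 1 B] [Module.Finite B A] (i : F →+* B)
    (hi : i.FiniteType) {ι : Type u} (e : ι ≃ MaximalSpectrum B) (R : ι → Type u)
    [∀ p, CommRing (R p)] [∀ p, Algebra B (R p)] [∀ p, Algebra (R p) K]
    [∀ p, IsScalarTower B (R p) K] [∀ p, IsLocalization.AtPrime (R p) (e p).asIdeal]
    (j : ∀ p, F →+* R p) (hj : ∀ p, j p = (algebraMap B (R p)).comp i) :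
    quotientDim i (algebraMap B A) < Cardinal.aleph0 ∧
    quotientDim i (algebraMap B A) =
      Cardinal.sum fun p => quotientDim (j p) (algebraMap (R p) (integralClosure (R p) K)) := by
  let _ := i.toAlgebra
  have : Algebra.FiniteType F B := hi
  have : IsNoetherianRing B := Algebra.FiniteType.isNoetherianRing F B
  let _ : Module F (A ⧸ LinearMap.range (Algebra.linearMap B A)) := Module.compHom _ i
  have : IsScalarTower F B (A ⧸ LinearMap.range (Algebra.linearMap B A)) :=
    .of_algebraMap_smul fun _ _ => rfl
  obtain ⟨c, hc, hcx⟩ := exists_smul_mem_range B A K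
  obtain ⟨h1, h2⟩ := rank_eq_sum_localizedRank F (isFiniteLength_of_smul_eq_zero c hc hcx)
  rw [quotientDim_eq i _ rfl fun _ _ => rfl]
  refine ⟨h1, h2.trans ?_⟩
  have h3 (p : ι) := localizedRank_eq_quotientDim B A K (e p).asIdeal (R p) (j p) (hj p)
  simp_rw [← h3]
  rw [← Cardinal.mk_out (Cardinal.sum _), ← Cardinal.mk_out (Cardinal.sum _)]
  simp only [Cardinal.sum, Cardinal.mk_out]
  exact (Cardinal.mk_congr (Equiv.sigmaCongrLeft (β := fun p : MaximalSpectrum B =>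
    (localizedRank F (A ⧸ LinearMap.range (Algebra.linearMap B A)) p.asIdeal).out) e)).symm

end

end OneBranch

namespace OneBranch

/-! ### Points of a one-dimensional integral scheme -/

section Dimension

variable {X : Scheme.{u}}

lemma krullDim_le_topologicalKrullDim : Order.krullDim X ≤ topologicalKrullDim X := by
  refine Order.krullDim_le_of_strictMono
    (fun x => (⟨closure {x}, isIrreducible_singleton.closure, isClosed_closure⟩ :
      TopologicalSpace.IrreducibleCloseds X)) fun x y h => ?_
  obtain ⟨h1, h2⟩ := lt_iff_le_not_ge.mp h
  refine lt_iff_le_not_ge.mpr ⟨?_, fun h3 => h2 ?_⟩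
  · exact Specializes.closure_subset h1
  · exact specializes_iff_closure_subset.mpr h3

lemma coheight_le_one (hdim : topologicalKrullDim X = 1) (x : X) : Order.coheight x ≤ 1 := by
  have := (Order.coheight_le_krullDim x).trans krullDim_le_topologicalKrullDim
  rw [hdim] at this
  exact_mod_cast this

variable [IsIntegral X] (hdim : topologicalKrullDim X = 1)

lemma one_le_coheight {x : X} (hx : x ≠ genericPoint X) : 1 ≤ Order.coheight x := by
  have hlt : x < genericPoint X := by
    refine lt_iff_le_not_ge.mpr ⟨genericPoint_specializes x, fun h => hx ?_⟩
    exact (Specializes.antisymm (y := genericPoint X) h (genericPoint_specializes x)).eq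
  have := Order.coheight_add_one_le hlt
  exact le_trans (by simp) this

include hdim

lemma coheight_eq_one {x : X} (hx : x ≠ genericPoint X) : Order.coheight x = 1 :=
  le_antisymm (coheight_le_one hdim x) (one_le_coheight hx)

/-- A proper specialization of `x` would have coheight at least two. -/
lemma isClosed_singleton_of_ne_genericPoint {x : X} (hx : x ≠ genericPoint X) :
    IsClosed ({x} : Set X) := by
  refine isClosed_of_closure_subset fun y hy => ?_
  have hxy : y ≤ x := specializes_iff_mem_closure.mpr hy
  by_contra hne
  have hlt : y < x := by
    refine lt_iff_le_not_ge.mpr ⟨hxy, fun h => hne ?_⟩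
    exact (Specializes.antisymm (x := x) (y := y) hxy h).eq.symm
  have h1 := Order.coheight_add_one_le hlt
  rw [coheight_eq_one hdim hx] at h1
  have := h1.trans (coheight_le_one hdim y)
  norm_num at this

/-- Otherwise the space is a single point, of dimension zero. -/
lemma not_isClosed_genericPoint : ¬ IsClosed ({genericPoint X} : Set X) := by
  intro h
  have huniv : ({genericPoint X} : Set X) = Set.univ := by
    rw [← h.closure_eq, genericPoint_closure]
  have : Subsingleton X := Set.subsingleton_univ_iff.mp (huniv ▸ Set.subsingleton_singleton)
  have h0 := topologicalKrullDim_zero_of_discreteTopology X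
  rw [hdim] at h0
  norm_num at h0

lemma isClosed_singleton_iff_ne_genericPoint {x : X} :
    IsClosed ({x} : Set X) ↔ x ≠ genericPoint X :=
  ⟨fun h e => not_isClosed_genericPoint hdim (e ▸ h), isClosed_singleton_of_ne_genericPoint hdim⟩

lemma isDiscreteValuationRing_stalk {x : X} (hx : x ≠ genericPoint X)
    [IsRegularLocalRing (X.presheaf.stalk x)] :
    IsDiscreteValuationRing (X.presheaf.stalk x) := by
  rw [← IsLocalRing.finrank_CotangentSpace_eq_one_iff]
  have h := (IsRegularLocalRing.iff_finrank_cotangentSpace (R := X.presheaf.stalk x)).mp ‹_›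
  rw [ringKrullDim_stalk_eq_coheight, coheight_eq_one hdim hx] at h
  exact_mod_cast h

end Dimension

/-! ### Orders of vanishing and the degree function -/

section ValuationRing

variable {R K : Type*} [CommRing R] [IsDomain R] [IsDiscreteValuationRing R] [Field K]
  [Algebra R K] [IsFractionRing R K]

lemma exists_algebraMap_eq_of_one_lt_ordFrac {f : K} (hf : 1 < Ring.ordFrac R f) :
    ∃ r ∈ IsLocalRing.maximalIdeal R, algebraMap R K r = f := by
  have hf0 : f ≠ 0 := by
    rintro rfl
    simp at hf
  have hmem : ∃ r, algebraMap R K r = f := by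
    rcases ValuationRing.isInteger_or_isInteger R f with h | ⟨r, hr⟩
    · exact h
    · have hr0 : r ≠ 0 := by
        rintro rfl
        rw [map_zero] at hr
        exact inv_ne_zero hf0 hr.symm
      have := Ring.ordFrac_ge_one_of_ne_zero (K := K) hr0
      rw [hr, map_inv₀] at this
      have h2 := inv_lt_one_of_one_lt₀ hf
      exact absurd this h2.not_ge
  obtain ⟨r, rfl⟩ := hmem
  refine ⟨r, ?_, rfl⟩
  rw [IsLocalRing.mem_maximalIdeal, mem_nonunits_iff]
  intro hu
  rw [Ring.ordFrac_of_isUnit hu] at hf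
  exact lt_irrefl _ hf

lemma one_lt_ordFrac {r : R} (hr : r ∈ IsLocalRing.maximalIdeal R) (hr0 : r ≠ 0) :
    1 < Ring.ordFrac R (algebraMap R K r) := by
  refine lt_of_le_of_ne (Ring.ordFrac_ge_one_of_ne_zero hr0) fun h => ?_
  exact hr (Ring.isUnit_iff_ordFrac_one_of_isDiscreteValuationRing.mpr h.symm)

end ValuationRing

section PoleOrders

variable {X : Scheme.{u}} {F : Type u} [Field F] (s : X ⟶ Spec (.of F))

lemma baseToSections_comp_map {U V : X.Opens} (h : U ≤ V) :
    (X.presheaf.map (homOfLE h).op).hom.comp (baseToSections s V) = baseToSections s U := by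
  refine (CommRingCat.hom_comp _ _).symm.trans (congrArg CommRingCat.Hom.hom ?_)
  rw [Category.assoc]
  exact congrArg _ (s.appLE_map (U := ⊤) le_top (homOfLE h).op)

lemma germ_baseToSections {U : X.Opens} {x : X} (hx : x ∈ U) (c : F) :
    X.presheaf.germ U x hx (baseToSections s U c) = baseToStalk s x c := by
  rw [← baseToSections_comp_map s (le_top : U ≤ ⊤), RingHom.comp_apply]
  exact X.presheaf.germ_res_apply (homOfLE le_top) x hx _

variable [IsIntegral X]

/-- A function on the complement of a point which is regular at that point is a global function. -/
lemma exists_global_of_germ {x : X} {C : X.Opens} (hC : (C : Set X) = {x}ᶜ) [Nonempty C]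
    (f : Γ(X, C)) (r : X.presheaf.stalk x)
    (hr : algebraMap _ X.functionField r = X.germToFunctionField C f) :
    ∃ g : Γ(X, ⊤), X.presheaf.germ ⊤ x (TopologicalSpace.Opens.mem_top x) g = r := by
  obtain ⟨V, hxV, h, rfl⟩ := X.presheaf.exists_germ_eq r
  have : Nonempty V := ⟨⟨x, hxV⟩⟩
  have hne : Nonempty (C ⊓ V : X.Opens) := by
    refine ⟨⟨genericPoint X, ?_, ?_⟩⟩
    · exact ((genericPoint_spec X).mem_open_set_iff C.isOpen).mpr
        (by simpa using Set.nonempty_coe_sort.mp ‹Nonempty C›)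
    · exact ((genericPoint_spec X).mem_open_set_iff V.isOpen).mpr
        (by simpa using Set.nonempty_coe_sort.mp ‹Nonempty V›)
  have key : X.presheaf.map (homOfLE (inf_le_left : C ⊓ V ≤ C)).op f =
      X.presheaf.map (homOfLE (inf_le_right : C ⊓ V ≤ V)).op h := by
    apply X.germToFunctionField_injective (C ⊓ V)
    rw [Scheme.algebraMap_germ_eq_germToFunctionField] at hr
    have e1 := X.presheaf.germ_res_apply (homOfLE (inf_le_left : C ⊓ V ≤ C)) (genericPoint X)
      (((genericPoint_spec X).mem_open_set_iff (C ⊓ V).isOpen).mpr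
        (by simpa using Set.nonempty_coe_sort.mp hne)) f
    have e2 := X.presheaf.germ_res_apply (homOfLE (inf_le_right : C ⊓ V ≤ V)) (genericPoint X)
      (((genericPoint_spec X).mem_open_set_iff (C ⊓ V).isOpen).mpr
        (by simpa using Set.nonempty_coe_sort.mp hne)) h
    exact e1.trans (hr.symm.trans e2.symm)
  -- `f` on `C` and `h` on `V` agree on the overlap as rational functions, so they glue; `C` and `V`
  -- cover because `C` misses only `x`.
  let p : CommRingCat.of (RingHom.eqLocus
      (RingHom.comp (X.sheaf.obj.map (homOfLE inf_le_left : C ⊓ V ⟶ C).op).hom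
        (RingHom.fst (X.sheaf.obj.obj <| .op C) (X.sheaf.obj.obj <| .op V)))
      (RingHom.comp (X.sheaf.obj.map (homOfLE inf_le_right : C ⊓ V ⟶ V).op).hom
        (RingHom.snd (X.sheaf.obj.obj <| .op C) (X.sheaf.obj.obj <| .op V)))) := ⟨(f, h), key⟩
  have htop : (⊤ : X.Opens) ≤ C ⊔ V := by
    intro y _
    by_cases hy : y = x
    · exact Or.inr (hy ▸ hxV)
    · exact Or.inl (show y ∈ (C : Set X) by rw [hC]; exact hy)
  let g := (X.sheaf.objSupIsoProdEqLocus C V).inv p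
  have hg : X.presheaf.map (homOfLE le_sup_right).op g = h :=
    X.sheaf.objSupIsoProdEqLocus_inv_snd C V p
  refine ⟨X.presheaf.map (homOfLE htop).op g, ?_⟩
  rw [← hg]
  exact (X.presheaf.germ_res_apply (homOfLE htop) x (TopologicalSpace.Opens.mem_top x) g).trans
    (X.presheaf.germ_res_apply (homOfLE le_sup_right) x hxV g).symm

/-- The pole order at a rational regular point is a degree function on the functions that are
regular elsewhere, on a proper curve. -/
theorem isDegree_neg_ord [IsLocallyNoetherian X] [UniversallyClosed s]
    (x : X) (hx : Order.coheight x = 1) [IsDiscreteValuationRing (X.presheaf.stalk x)]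
    (hres : ∀ r : X.presheaf.stalk x, ∃ c : F,
      r - baseToStalk s x c ∈ IsLocalRing.maximalIdeal (X.presheaf.stalk x))
    (C : X.Opens) (hC : (C : Set X) = {x}ᶜ) [Nonempty C] [Module F Γ(X, C)]
    (hsmul : ∀ (c : F) (f : Γ(X, C)), c • f = baseToSections s C c * f) :
    IsDegree F fun f : Γ(X, C) => -Scheme.ord (X.germToFunctionField C f) x := by
  have hinj := X.germToFunctionField_injective C
  have h0 {f : Γ(X, C)} (hf : f ≠ 0) : X.germToFunctionField C f ≠ 0 := by
    rwa [Ne, map_eq_zero_iff _ hinj]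
  have hconst (c : F) (f : Γ(X, C)) : X.germToFunctionField C (c • f) =
      algebraMap (X.presheaf.stalk x) _ (baseToStalk s x c) * X.germToFunctionField C f := by
    rw [hsmul, map_mul]
    congr 1
    have hη : genericPoint X ∈ C := ((genericPoint_spec X).mem_open_set_iff C.isOpen).mpr
        (by simpa using Set.nonempty_coe_sort.mp ‹Nonempty C›)
    have : Nonempty (⊤ : X.Opens) := ⟨⟨x, TopologicalSpace.Opens.mem_top x⟩⟩
    rw [← germ_baseToSections s (TopologicalSpace.Opens.mem_top x), Scheme.algebraMap_germ_eq_germToFunctionField]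
    exact (germ_baseToSections s hη c).trans (germ_baseToSections s (TopologicalSpace.Opens.mem_top _) c).symm
  have hpos {f : X.functionField} (hf : f ≠ 0) :
      0 < Scheme.ord f x ↔ 1 < Ring.ordFrac (X.presheaf.stalk x) f := by
    have := (Scheme.ord_le_ord_iff hx hx hf (one_ne_zero)).not
    rw [not_le, not_le] at this
    have h1 : Scheme.ord (1 : X.functionField) x = 0 := by
      rw [Scheme.ord_eq_iff hx one_ne_zero, map_one]; rfl
    rw [h1, map_one] at this
    exact this
  refine ⟨fun f hf => ?_, fun c f hc hf => ?_, fun f g hf hg hfg => ?_, fun f g hf hg hfg => ?_⟩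
  -- A negative degree means a zero at `x`; then `f` extends to a global section, which is zero or a
  -- unit, and both are impossible.
  · by_contra! hlt
    have hlt' : 0 < Scheme.ord (X.germToFunctionField C f) x := by linarith
    rw [hpos (h0 hf)] at hlt'
    obtain ⟨r, hr, hrf⟩ := exists_algebraMap_eq_of_one_lt_ordFrac hlt'
    obtain ⟨g, hg⟩ := exists_global_of_germ hC f r hrf
    by_cases hg0 : g = 0
    · rw [hg0, map_zero] at hg
      rw [← hg, map_zero] at hrf
      exact h0 hf hrf.symm
    · obtain ⟨g', hg'⟩ := (isField_of_universallyClosed F s).mul_inv_cancel hg0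
      refine hr (hg ▸ (IsUnit.of_mul_eq_one g' hg').map (X.presheaf.germ ⊤ x (TopologicalSpace.Opens.mem_top x)).hom)
  · dsimp only
    have hc' : baseToStalk s x c ≠ 0 := by simpa using hc
    have hc'' : algebraMap (X.presheaf.stalk x) X.functionField (baseToStalk s x c) ≠ 0 := by
      rwa [Ne, map_eq_zero_iff _ (IsFractionRing.injective (X.presheaf.stalk x) X.functionField)]
    rw [hconst, Scheme.ord_mul hc'' (h0 hf)]
    have : Scheme.ord (algebraMap (X.presheaf.stalk x) X.functionField (baseToStalk s x c)) x = 0 := by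
      rw [Scheme.ord_eq_iff hx hc'']
      exact Ring.ordFrac_of_isUnit ((IsUnit.mk0 c hc).map (baseToStalk s x))
    rw [this, zero_add]
  · have := Scheme.ord_add (x := x) (f := X.germToFunctionField C f)
      (g := X.germToFunctionField C g) (by rw [← map_add]; exact h0 hfg)
    rw [← map_add] at this
    dsimp only
    rw [max_neg_neg]
    exact neg_le_neg this
  · dsimp only at hfg ⊢
    have hfg' : Ring.ordFrac (X.presheaf.stalk x) (X.germToFunctionField C g) =
        Ring.ordFrac (X.presheaf.stalk x) (X.germToFunctionField C f) := by
      apply le_antisymm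
      · exact (Scheme.ord_le_ord_iff hx hx (h0 hg) (h0 hf)).mp (by linarith)
      · exact (Scheme.ord_le_ord_iff hx hx (h0 hf) (h0 hg)).mp (by linarith)
    -- Here `f = u * g` with `u` a unit at `x`; subtracting the value `c` of `u` gives `(u - c) *
    -- g`, of larger order.
    obtain ⟨u, hu⟩ := Ring.associated_of_ordFrac_eq _ _ hfg'
    obtain ⟨c, hc⟩ := hres u
    refine ⟨c, fun hne => ?_⟩
    have e : X.germToFunctionField C (f - c • g) =
        algebraMap (X.presheaf.stalk x) _ (u - baseToStalk s x c) * X.germToFunctionField C g := by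
      rw [map_sub, hconst, ← hu, map_sub, sub_mul, Units.smul_def, Algebra.smul_def]
    have hr0 : (u : X.presheaf.stalk x) - baseToStalk s x c ≠ 0 := by
      intro h
      rw [h, map_zero, zero_mul] at e
      exact h0 hne e
    have hr1 : algebraMap (X.presheaf.stalk x) X.functionField (u - baseToStalk s x c) ≠ 0 := by
      rwa [Ne, map_eq_zero_iff _ (IsFractionRing.injective (X.presheaf.stalk x) X.functionField)]
    have h3 := (hpos hr1).mpr (one_lt_ordFrac hc hr0)
    rw [e, Scheme.ord_mul hr1 (h0 hg)]
    linarith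

end PoleOrders

end OneBranch

namespace OneBranch

/-! ### Geometric points and residue fields -/

section GeometricPoints

variable {F : Type u} [Field F] {X : Scheme.{u}} (s : X ⟶ Spec (.of F))

lemma fromSpecStalk_comp (x : X) :
    X.fromSpecStalk x ≫ s = Spec.map (CommRingCat.ofHom (baseToStalk s x)) := by
  apply ext_of_isAffine
  rw [Scheme.Hom.comp_appTop, Scheme.fromSpecStalk_appTop]
  rw [← cancel_epi (Scheme.ΓSpecIso (.of F)).inv, ← Scheme.ΓSpecIso_inv_naturality]
  have h : CommRingCat.ofHom (baseToStalk s x) =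
      (Scheme.ΓSpecIso (.of F)).inv ≫ s.appTop ≫ X.presheaf.germ ⊤ x trivial := by
    rw [Scheme.Hom.appTop, Scheme.Hom.app_eq_appLE]
    rfl
  rw [h]
  simp only [Category.assoc]
  congr 3

/-- The residue field of a point of an `F`-scheme as an extension of `F`. -/
noncomputable def baseToResidueField (x : X) : F →+* X.residueField x :=
  (X.residue x).hom.comp (baseToStalk s x)

lemma fromSpecResidueField_comp (x : X) :
    X.fromSpecResidueField x ≫ s = Spec.map (CommRingCat.ofHom (baseToResidueField s x)) := by
  rw [Scheme.fromSpecResidueField, Category.assoc, fromSpecStalk_comp, ← Spec.map_comp]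
  rfl

/-- The composite to `Spec F` is integral, hence universally closed; as `s` is separated, `q` itself
is a closed map, with one-point image. -/
lemma isClosed_singleton_point [IsSeparated s] (q : GeometricPoint s) :
    IsClosed ({q.point} : Set X) := by
  have : IsIntegralHom (q.1 ≫ s) := by
    rw [q.2, IsIntegralHom.SpecMap_iff]
    exact algebraMap_isIntegral_iff.mpr inferInstance
  have : UniversallyClosed q.1 := UniversallyClosed.of_comp_of_isSeparated q.1 s
  have h := q.1.isClosedMap.isClosed_range
  rwa [Set.range_eq_singleton (y := q.point)] at h
  exact fun x => congrArg q.1 (Subsingleton.elim _ _)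

/-- The geometric point given by an embedding of a residue field. -/
noncomputable def geometricPointOfHom (x : X) (φ : X.residueField x →+* AlgebraicClosure F)
    (hφ : φ.comp (baseToResidueField s x) = algebraMap F (AlgebraicClosure F)) :
    GeometricPoint s :=
  ⟨Spec.map (CommRingCat.ofHom φ) ≫ X.fromSpecResidueField x, by
    rw [Category.assoc, fromSpecResidueField_comp, ← Spec.map_comp, ← hφ]
    rfl⟩

lemma geometricPointOfHom_point (x : X) (φ : X.residueField x →+* AlgebraicClosure F)
    (hφ : φ.comp (baseToResidueField s x) = algebraMap F (AlgebraicClosure F)) :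
    (geometricPointOfHom s x φ hφ).point = x := by
  exact X.fromSpecResidueField_apply x _

lemma finite_residueField [LocallyOfFiniteType s] {x : X} (hx : IsClosed ({x} : Set X)) :
    (baseToResidueField s x).Finite := by
  have : IsFinite (X.fromSpecResidueField x ≫ s) := by
    rw [isClosed_singleton_iff_isClosedImmersion] at hx
    rw [isFinite_iff_locallyOfFiniteType_of_jacobsonSpace]
    infer_instance
  rw [fromSpecResidueField_comp] at this
  exact (IsFinite.SpecMap_iff _).mp this

lemma exists_geometricPoint [LocallyOfFiniteType s] {x : X} (hx : IsClosed ({x} : Set X)) :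
    ∃ q : GeometricPoint s, q.point = x := by
  let _ := (baseToResidueField s x).toAlgebra
  have : Module.Finite F (X.residueField x) := finite_residueField s hx
  let φ : X.residueField x →ₐ[F] AlgebraicClosure F := IsAlgClosed.lift
  exact ⟨_, geometricPointOfHom_point s x φ.toRingHom φ.comp_algebraMap⟩

/-- Over a perfect field the degree of the residue field is its number of embeddings into the
algebraic closure. Distinct embeddings give distinct geometric points at `x`, so the degree is one.
-/
lemma exists_sub_mem_maximalIdeal [PerfectField F] [LocallyOfFiniteType s] {x : X}
    (hx : IsClosed ({x} : Set X)) (huniq : ∀ q q' : GeometricPoint s, q.point = x →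
      q'.point = x → q = q') (r : X.presheaf.stalk x) :
    ∃ c : F, r - baseToStalk s x c ∈ IsLocalRing.maximalIdeal (X.presheaf.stalk x) := by
  let _ := (baseToResidueField s x).toAlgebra
  have : Module.Finite F (X.residueField x) := finite_residueField s hx
  have hsub : Subsingleton (X.residueField x →ₐ[F] AlgebraicClosure F) := by
    refine ⟨fun φ ψ => ?_⟩
    have h := huniq _ _ (geometricPointOfHom_point s x φ.toRingHom φ.comp_algebraMap)
      (geometricPointOfHom_point s x ψ.toRingHom ψ.comp_algebraMap)
    have h' := congrArg Subtype.val h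
    simp only [geometricPointOfHom, cancel_mono] at h'
    exact AlgHom.coe_ringHom_injective congr(CommRingCat.Hom.hom $(Spec.map_injective h'))
  have hrank : Module.finrank F (X.residueField x) = 1 := by
    rw [← AlgHom.card F (X.residueField x) (AlgebraicClosure F)]
    have : Nonempty (X.residueField x →ₐ[F] AlgebraicClosure F) := ⟨IsAlgClosed.lift⟩
    exact Fintype.card_eq_one_iff_nonempty_unique.mpr ⟨uniqueOfSubsingleton (Classical.arbitrary _)⟩
  obtain ⟨c, hc⟩ := (finrank_eq_one_iff_of_nonzero' (1 : X.residueField x) one_ne_zero).mp hrank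
    (X.residue x r)
  rw [Algebra.smul_def, mul_one] at hc
  refine ⟨c, ?_⟩
  rw [← IsLocalRing.residue_eq_zero_iff, map_sub, sub_eq_zero]
  exact hc.symm

end GeometricPoints

end OneBranch

namespace OneBranch

attribute [local instance] MvPolynomial.gradedAlgebra

/-! ### Finiteness and separatedness of the plane -/

section Plane

variable (F : Type u) [Field F]

lemma algebraMap_homogeneousSubmodule_zero_surjective :
    Function.Surjective (algebraMap F (MvPolynomial.homogeneousSubmodule (Fin 3) F 0)) := by
  rintro ⟨p, hp⟩
  rw [MvPolynomial.homogeneousSubmodule_zero] at hp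
  obtain ⟨c, hc⟩ := Submodule.mem_one.mp hp
  exact ⟨c, Subtype.ext hc⟩

instance : IsSeparated (planeToBase F) := by
  have := IsClosedImmersion.spec_of_surjective (CommRingCat.ofHom
      (algebraMap F (MvPolynomial.homogeneousSubmodule (Fin 3) F 0)))
    (algebraMap_homogeneousSubmodule_zero_surjective F)
  unfold planeToBase
  infer_instance

instance : LocallyOfFiniteType (planeToBase F) := by
  have := IsClosedImmersion.spec_of_surjective (CommRingCat.ofHom
      (algebraMap F (MvPolynomial.homogeneousSubmodule (Fin 3) F 0)))
    (algebraMap_homogeneousSubmodule_zero_surjective F)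
  have : IsScalarTower F (MvPolynomial.homogeneousSubmodule (Fin 3) F 0)
      (MvPolynomial (Fin 3) F) := ⟨fun x y z => smul_mul_assoc x (y : MvPolynomial (Fin 3) F) z⟩
  have : Algebra.FiniteType (MvPolynomial.homogeneousSubmodule (Fin 3) F 0)
      (MvPolynomial (Fin 3) F) := Algebra.FiniteType.of_restrictScalars_finiteType F _ _
  unfold planeToBase
  infer_instance

end Plane

/-- In a Jacobson space a closed set is the closure of its closed points. This turns hypotheses on
geometric points, which see only closed points, into equalities of sets. -/
lemma eq_singleton_of_closedPoints {X : Type*} [TopologicalSpace X] [JacobsonSpace X] {W : Set X}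
    (hW : IsClosed W) {p : X} (hp : IsClosed ({p} : Set X)) (hpW : p ∈ W)
    (h : ∀ x ∈ W, IsClosed ({x} : Set X) → x = p) : W = {p} := by
  have h1 : W ∩ closedPoints X = {p} := by
    ext x
    refine ⟨fun hx => h x hx.1 hx.2, ?_⟩
    rintro rfl
    exact ⟨hpW, hp⟩
  rw [← hW.closure_eq, ← JacobsonSpace.closure_inter_closedPoints_eq_closure hW.isLocallyClosed,
    h1, hp.closure_eq]

/-- An affine open subset is homeomorphic to the prime spectrum of its ring of functions. -/
noncomputable def affineHomeomorph {X : Scheme.{u}} {U : X.Opens} (hU : IsAffineOpen U) :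
    U ≃ₜ PrimeSpectrum Γ(X, U) :=
  hU.isoSpec.hom.homeomorph

/-! ### Proper birational morphisms from a regular curve -/

section Curve

variable {χ Υ : Scheme.{u}} [IsIntegral χ] [IsIntegral Υ] {n : χ ⟶ Υ}

lemma IsBirationalMorphism.surjective (hn : IsBirationalMorphism n) [IsProper n] :
    Function.Surjective n := by
  rw [← Set.range_eq_univ, ← n.isClosedMap.isClosed_range.closure_eq, Set.eq_univ_iff_forall]
  intro y
  exact (genericPoint_specializes y).mem_closed isClosed_closure
    (subset_closure ⟨_, hn.1⟩)

variable (hdim : topologicalKrullDim χ = 1)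
include hdim

lemma IsBirationalMorphism.isClosed_singleton (hn : IsBirationalMorphism n) [IsProper n] {y : Υ}
    (hy : y ≠ genericPoint Υ) : IsClosed ({y} : Set Υ) := by
  obtain ⟨x, rfl⟩ := hn.surjective y
  have hx : x ≠ genericPoint χ := by
    rintro rfl
    exact hy hn.1
  rw [← Set.image_singleton]
  exact n.isClosedMap _ (isClosed_singleton_of_ne_genericPoint hdim hx)

lemma finite_of_isClosed [TopologicalSpace.NoetherianSpace χ] {W : Set χ} (hW : IsClosed W)
    (hη : genericPoint χ ∉ W) : W.Finite := by
  obtain ⟨S, hS, hcl, hirr, rfl⟩ :=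
    TopologicalSpace.NoetherianSpace.exists_finite_set_isClosed_irreducible hW
  refine hS.sUnion fun t ht => ?_
  obtain ⟨g, hg⟩ := QuasiSober.sober (hirr t ht) (hcl t ht)
  have hgt : g ∈ t := hg.mem
  have hgη : g ≠ genericPoint χ := by
    rintro rfl
    exact hη ⟨t, ht, hgt⟩
  rw [← hg.def, (isClosed_singleton_of_ne_genericPoint hdim hgη).closure_eq]
  exact Set.finite_singleton g

/-- Proper and quasi-finite implies finite. Fibres over other points are closed and miss the generic
point; a closed point over the generic point would make the latter closed. -/
lemma IsBirationalMorphism.isFinite [TopologicalSpace.NoetherianSpace χ]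
    (hn : IsBirationalMorphism n) [IsProper n] (hη : ¬ IsClosed ({genericPoint Υ} : Set Υ)) :
    IsFinite n := by
  have : LocallyQuasiFinite n := by
    refine .of_finite_preimage_singleton n fun y => ?_
    by_cases hy : y = genericPoint Υ
    · subst hy
      refine (Set.finite_singleton (genericPoint χ)).subset fun x hx => ?_
      by_contra hxη
      refine hη ?_
      rw [← show n x = genericPoint Υ from hx, ← Set.image_singleton]
      exact n.isClosedMap _ (isClosed_singleton_of_ne_genericPoint hdim hxη)
    · refine finite_of_isClosed hdim
        ((hn.isClosed_singleton hdim hy).preimage n.continuous) fun h => hy ?_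
      rw [← show n (genericPoint χ) = y from h, hn.1]
  exact IsFinite.of_isProper_of_locallyQuasiFinite n

/-- Normality is local, and each stalk is a discrete valuation ring or the function field. -/
lemma isIntegrallyClosed_sections (hreg : ∀ x : χ, IsRegularLocalRing (χ.presheaf.stalk x))
    {C : χ.Opens} (hC : IsAffineOpen C) [Nonempty C] : IsIntegrallyClosed Γ(χ, C) := by
  have hstalk (x : χ) : IsIntegrallyClosed (χ.presheaf.stalk x) := by
    by_cases hx : x = genericPoint χ
    · subst hx
      exact inferInstanceAs (IsIntegrallyClosed χ.functionField)
    · have := hreg x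
      have := isDiscreteValuationRing_stalk hdim hx
      infer_instance
  refine IsIntegrallyClosed.of_localization_maximal fun p _ _ => ?_
  obtain ⟨x, hx⟩ : ∃ x : C, hC.primeIdealOf x = ⟨p, inferInstance⟩ :=
    (affineHomeomorph hC).surjective ⟨p, inferInstance⟩
  have hloc := hC.isLocalization_stalk x
  rw [hx] at hloc
  have := hstalk x
  exact IsIntegrallyClosed.of_equiv
    (IsLocalization.algEquiv p.primeCompl (χ.presheaf.stalk x.1) (Localization.AtPrime p)).toRingEquiv

lemma IsBirationalMorphism.krullDimLE (hn : IsBirationalMorphism n) [IsProper n]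
    {Z : Υ.Opens} (hZ : IsAffineOpen Z) [Nonempty Z] : Ring.KrullDimLE 1 Γ(Υ, Z) := by
  rw [Ring.krullDimLE_one_iff_of_isPrime_bot]
  intro p hp hp0
  obtain ⟨y, hy⟩ : ∃ y : Z, hZ.primeIdealOf y = ⟨p, inferInstance⟩ :=
    (affineHomeomorph hZ).surjective ⟨p, inferInstance⟩
  have hyη : y.1 ≠ genericPoint Υ := by
    intro h
    have h1 := hZ.primeIdealOf_genericPoint
    rw [show (⟨genericPoint Υ, _⟩ : Z) = y from Subtype.ext h.symm, hy,
      genericPoint_eq_bot_of_affine] at h1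
    exact hp (congrArg PrimeSpectrum.asIdeal h1)
  have := hZ.primeIdealOf_isMaximal_of_isClosed y (hn.isClosed_singleton hdim hyη)
  rwa [hy] at this

end Curve

end OneBranch

namespace OneBranch

lemma isClosed_singleton_apply_iff {X Y : Type*} [TopologicalSpace X] [TopologicalSpace Y]
    (e : X ≃ₜ Y) {x : X} : IsClosed ({e x} : Set Y) ↔ IsClosed ({x} : Set X) := by
  rw [← Set.image_singleton, e.isClosed_image]

/-! ### Coordinate rings inside the common function field -/

section Birational

variable {χ Υ : Scheme.{u}} [IsIntegral χ] [IsIntegral Υ] {n : χ ⟶ Υ}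

/-- A birational morphism identifies the function fields. -/
noncomputable def IsBirationalMorphism.functionFieldEquiv (hn : IsBirationalMorphism n) :
    Υ.functionField ≃+* χ.functionField :=
  haveI := hn.2
  (Υ.presheaf.stalkCongr (.of_eq hn.1.symm) ≪≫
    asIso (n.stalkMap (genericPoint χ))).commRingCatIsoToRingEquiv

lemma IsBirationalMorphism.functionFieldEquiv_germ (hn : IsBirationalMorphism n) {Z : Υ.Opens}
    {C : χ.Opens} [Nonempty Z] [Nonempty C] (h : C ≤ n ⁻¹ᵁ Z) (f : Γ(Υ, Z)) :
    hn.functionFieldEquiv (Υ.germToFunctionField Z f) =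
      χ.germToFunctionField C (n.appLE Z C h f) := by
  have hηC : genericPoint χ ∈ C := ((genericPoint_spec χ).mem_open_set_iff C.isOpen).mpr
    (by simpa using Set.nonempty_coe_sort.mp ‹Nonempty C›)
  have hηZ : genericPoint Υ ∈ Z := ((genericPoint_spec Υ).mem_open_set_iff Z.isOpen).mpr
    (by simpa using Set.nonempty_coe_sort.mp ‹Nonempty Z›)
  have key : Υ.presheaf.germ Z (genericPoint Υ) hηZ ≫
      Υ.presheaf.stalkSpecializes (specializes_of_eq hn.1) ≫ n.stalkMap (genericPoint χ) =
      n.appLE Z C h ≫ χ.presheaf.germ C (genericPoint χ) hηC := by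
    rw [TopCat.Presheaf.germ_stalkSpecializes_assoc, Scheme.Hom.germ_stalkMap,
      Scheme.Hom.app_eq_appLE, ← χ.presheaf.germ_res (homOfLE h) _ hηC,
      Scheme.Hom.appLE_map_assoc]
  exact congr(CommRingCat.Hom.hom $key f)

lemma IsBirationalMorphism.appLE_injective (hn : IsBirationalMorphism n) {Z : Υ.Opens}
    {C : χ.Opens} [Nonempty Z] [Nonempty C] (h : C ≤ n ⁻¹ᵁ Z) :
    Function.Injective (n.appLE Z C h) := by
  intro f g hfg
  apply Υ.germToFunctionField_injective Z
  apply hn.functionFieldEquiv.injective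
  rw [hn.functionFieldEquiv_germ h, hn.functionFieldEquiv_germ h, hfg]

/-- Integral over the smaller ring implies integral over the larger one, which is integrally closed;
conversely, finite extensions are integral. -/
lemma IsBirationalMorphism.isIntegral_iff (hn : IsBirationalMorphism n) {Z : Υ.Opens}
    {C : χ.Opens} [Nonempty Z] [Nonempty C] (h : C ≤ n ⁻¹ᵁ Z)
    (hfin : (n.appLE Z C h).hom.Finite) [IsIntegrallyClosed Γ(χ, C)]
    [IsFractionRing Γ(χ, C) χ.functionField] {x : Υ.functionField} :
    IsIntegral Γ(Υ, Z) x ↔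
      ∃ y : Γ(χ, C), hn.functionFieldEquiv.symm (χ.germToFunctionField C y) = x := by
  have hcomp : hn.functionFieldEquiv.toRingHom.comp (algebraMap Γ(Υ, Z) Υ.functionField) =
      (algebraMap Γ(χ, C) χ.functionField).comp (n.appLE Z C h).hom :=
    RingHom.ext fun f => hn.functionFieldEquiv_germ h f
  constructor
  · rintro ⟨p, hp, hpx⟩
    have hx : IsIntegral Γ(χ, C) (hn.functionFieldEquiv x) := by
      refine ⟨p.map (n.appLE Z C h).hom, hp.map _, ?_⟩
      rw [Polynomial.eval₂_map, ← hcomp]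
      have := congrArg hn.functionFieldEquiv.toRingHom hpx
      rwa [Polynomial.hom_eval₂, map_zero] at this
    obtain ⟨y, hy⟩ := IsIntegrallyClosed.isIntegral_iff.mp hx
    refine ⟨y, ?_⟩
    rw [RingEquiv.symm_apply_eq]
    exact hy
  · rintro ⟨y, rfl⟩
    obtain ⟨p, hp, hpy⟩ := hfin.to_isIntegral y
    refine ⟨p, hp, hn.functionFieldEquiv.injective ?_⟩
    have h1 := Polynomial.hom_eval₂ p (algebraMap Γ(Υ, Z) Υ.functionField)
      hn.functionFieldEquiv.toRingHom (hn.functionFieldEquiv.symm (χ.germToFunctionField C y))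
    rw [hcomp] at h1
    rw [map_zero]
    refine h1.trans ?_
    have h2 := Polynomial.hom_eval₂ p (n.appLE Z C h).hom (algebraMap Γ(χ, C) χ.functionField) y
    rw [hpy, map_zero] at h2
    rw [h2]
    congr 1
    exact hn.functionFieldEquiv.apply_symm_apply _

/-- The codimension of the coordinate ring of a curve in that of its normalization is the sum of
the local invariants. -/
theorem IsBirationalMorphism.quotientDim_eq_sum_delta {F : Type u} [Field F]
    (hn : IsBirationalMorphism n) (t : Υ ⟶ Spec (.of F)) [LocallyOfFiniteType t] [IsFinite n]
    (hdim : topologicalKrullDim χ = 1)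
    (hreg : ∀ x : χ, IsRegularLocalRing (χ.presheaf.stalk x))
    {Z : Υ.Opens} (hZ : IsAffineOpen Z) [Nonempty Z] [Nonempty (n ⁻¹ᵁ Z)] :
    quotientDim (baseToSections t Z) (n.appLE Z (n ⁻¹ᵁ Z) le_rfl).hom < Cardinal.aleph0 ∧
    quotientDim (baseToSections t Z) (n.appLE Z (n ⁻¹ᵁ Z) le_rfl).hom =
      Cardinal.sum (fun Q : {Q : Z // IsClosed ({Q} : Set Z)} => delta t Q.1.1) := by
  have hC : IsAffineOpen (n ⁻¹ᵁ Z) := hZ.preimage n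
  have := isIntegrallyClosed_sections hdim hreg hC
  have := functionField_isFractionRing_of_isAffineOpen χ (n ⁻¹ᵁ Z) hC
  have := functionField_isFractionRing_of_isAffineOpen Υ Z hZ
  have := hn.krullDimLE hdim hZ
  have hfin : (n.appLE Z (n ⁻¹ᵁ Z) le_rfl).hom.Finite := by
    rw [← Scheme.Hom.app_eq_appLE]
    exact n.finite_app Z hZ
  let _ : Algebra Γ(Υ, Z) Γ(χ, n ⁻¹ᵁ Z) := (n.appLE Z (n ⁻¹ᵁ Z) le_rfl).hom.toAlgebra
  -- `delta` normalizes inside the function field of `Υ`, so the functions on `χ` are transported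
  -- there.
  let _ : Algebra Γ(χ, n ⁻¹ᵁ Z) Υ.functionField :=
    (hn.functionFieldEquiv.symm.toRingHom.comp (χ.germToFunctionField (n ⁻¹ᵁ Z)).hom).toAlgebra
  have : Module.Finite Γ(Υ, Z) Γ(χ, n ⁻¹ᵁ Z) := hfin
  have : IsScalarTower Γ(Υ, Z) Γ(χ, n ⁻¹ᵁ Z) Υ.functionField := .of_algebraMap_eq fun f => by
    refine (hn.functionFieldEquiv.symm_apply_eq.mpr ?_).symm
    exact (hn.functionFieldEquiv_germ le_rfl f).symm
  have : IsIntegralClosure Γ(χ, n ⁻¹ᵁ Z) Γ(Υ, Z) Υ.functionField :=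
    ⟨hn.functionFieldEquiv.symm.injective.comp (χ.germToFunctionField_injective _),
      hn.isIntegral_iff le_rfl hfin⟩
  let e : {Q : Z // IsClosed ({Q} : Set Z)} ≃ MaximalSpectrum Γ(Υ, Z) :=
    ((affineHomeomorph hZ).toEquiv.subtypeEquiv fun Q =>
      (isClosed_singleton_apply_iff (affineHomeomorph hZ)).symm : _ ≃ {p : PrimeSpectrum Γ(Υ, Z) // IsClosed ({p} : Set _)}).trans
    { toFun := fun p => ⟨p.1.asIdeal, p.1.isClosed_singleton_iff_isMaximal.mp p.2⟩
      invFun := fun p => ⟨⟨p.asIdeal, p.isMaximal.isPrime⟩,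
        (PrimeSpectrum.isClosed_singleton_iff_isMaximal _).mpr p.isMaximal⟩
      left_inv := fun _ => rfl
      right_inv := fun _ => rfl }
  let _ (Q : {Q : Z // IsClosed ({Q} : Set Z)}) :
      Algebra Γ(Υ, Z) (Υ.presheaf.stalk Q.1.1) := Υ.presheaf.algebra_section_stalk Q.1
  have (Q : {Q : Z // IsClosed ({Q} : Set Z)}) :
      IsScalarTower Γ(Υ, Z) (Υ.presheaf.stalk Q.1.1) Υ.functionField :=
    functionField_isScalarTower Υ Z Q.1
  have (Q : {Q : Z // IsClosed ({Q} : Set Z)}) :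
      IsLocalization.AtPrime (Υ.presheaf.stalk Q.1.1) (e Q).asIdeal :=
    hZ.isLocalization_stalk Q.1
  have hft : (baseToSections t Z).FiniteType := by
    have h1 := t.finiteType_appLE (isAffineOpen_top _) hZ le_top
    exact h1.comp (RingHom.FiniteType.of_surjective _
      (Scheme.ΓSpecIso (.of F)).symm.commRingCatIsoToRingEquiv.surjective)
  exact quotientDim_eq_sum Γ(Υ, Z) Γ(χ, n ⁻¹ᵁ Z) Υ.functionField (baseToSections t Z) hft e
    (fun Q => Υ.presheaf.stalk Q.1.1) (fun Q => baseToStalk t Q.1.1)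
    (fun Q => RingHom.ext fun c => (germ_baseToSections t Q.1.2 c).symm)

end Birational

end OneBranch

/-! ### Assembling the two computations -/

namespace OneBranch

attribute [local instance] MvPolynomial.gradedAlgebra

lemma appLE_comp_baseToSections {F : Type u} [Field F] {X Y : Scheme.{u}} {n : X ⟶ Y}
    {t : Y ⟶ Spec (.of F)} {s : X ⟶ Spec (.of F)} (hnt : n ≫ t = s) {Z : Y.Opens} {C : X.Opens}
    (h : C ≤ n ⁻¹ᵁ Z) :
    (n.appLE Z C h).hom.comp (baseToSections t Z) = baseToSections s C := by
  subst hnt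
  refine (CommRingCat.hom_comp _ _).symm.trans (congrArg CommRingCat.Hom.hom ?_)
  rw [Category.assoc]
  exact congrArg _ (Scheme.Hom.appLE_comp_appLE n t ⊤ Z C le_top h)

/-- The number of pole orders that a subalgebra misses is its codimension. -/
theorem lift_mk_poleOrders_diff {F : Type u} [Field F] {X : Scheme.{u}} [IsIntegral X]
    (s : X ⟶ Spec (.of F)) [LocallyOfFiniteType s] [UniversallyClosed s]
    (x : X) (hx : Order.coheight x = 1) [IsDiscreteValuationRing (X.presheaf.stalk x)]
    (hres : ∀ r : X.presheaf.stalk x, ∃ c : F,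
      r - baseToStalk s x c ∈ IsLocalRing.maximalIdeal (X.presheaf.stalk x))
    (C : X.Opens) (hC : (C : Set X) = {x}ᶜ) [Nonempty C] {R : Type u} [CommRing R] (i : F →+* R)
    (φ : R →+* Γ(X, C)) (hφ : φ.comp i = baseToSections s C) :
    Cardinal.lift.{u} (Cardinal.mk
      ↥(poleOrders s x C Set.univ \ poleOrders s x C (Set.range φ))) = quotientDim i φ := by
  have : IsLocallyNoetherian X := LocallyOfFiniteType.isLocallyNoetherian s
  let _ : Algebra F R := i.toAlgebra
  let _ : Algebra R Γ(X, C) := φ.toAlgebra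
  let _ : Algebra F Γ(X, C) := (baseToSections s C).toAlgebra
  have : IsScalarTower F R Γ(X, C) := .of_algebraMap_eq' hφ.symm
  have hd := isDegree_neg_ord s x hx hres C hC fun _ _ => rfl
  have h := hd.lift_rank_quotient
    ((LinearMap.range (Algebra.linearMap R Γ(X, C))).restrictScalars F)
  rw [Cardinal.lift_uzero] at h
  rw [quotientDim_eq i φ rfl fun c y => (algebraMap_smul R c y).symm]
  refine Eq.trans ?_ h.symm
  congr 4
  · ext m
    simp [poleOrders, ‹Nonempty C›]
  · ext m
    simp only [poleOrders, ‹Nonempty C›, exists_true_left]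
    rfl

/-- The complement of a line is affine. -/
lemma isAffineOpen_of_eq_compl_preimage_zeroSet {F : Type u} [Field F] {Υ : Scheme.{u}}
    (ι : Υ ⟶ Plane F) [IsAffineHom ι] {l : MvPolynomial (Fin 3) F} (hl : l.IsHomogeneous 1)
    {Z : Υ.Opens} (hZ : (Z : Set Υ) = (ι ⁻¹' zeroSet l)ᶜ) : IsAffineOpen Z := by
  have : Z = ι ⁻¹ᵁ Proj.basicOpen (MvPolynomial.homogeneousSubmodule (Fin 3) F) l :=
    SetLike.ext' (hZ.trans (compl_compl _))
  rw [this]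
  exact (Proj.isAffineOpen_basicOpen _ l hl one_pos).preimage ι

lemma isClosed_zeroSet {F : Type u} [Field F] (l : MvPolynomial (Fin 3) F) :
    IsClosed (zeroSet l) :=
  (TopologicalSpace.Opens.isOpen _).isClosed_compl

end OneBranch

theorem mainTheorem6 {F : Type u} [Field F] [PerfectField F]
    -- the non-singular projective curve `χ`, irreducible over the algebraic closure of `F`
    (χ : Scheme.{u}) (s : χ ⟶ Spec (.of F)) [IsIntegral χ] [IsProper s]
    [GeometricallyIrreducible s] (hdim : topologicalKrullDim χ = 1)
    (hreg : ∀ x : χ, IsRegularLocalRing (χ.presheaf.stalk x))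
    -- the plane model `Υ ⊆ ℙ²` and the birational morphism `n : χ ⟶ Υ` over `F`
    (Υ : Scheme.{u}) [IsIntegral Υ] (ι : Υ ⟶ OneBranch.Plane F) [IsClosedImmersion ι]
    (t : Υ ⟶ Spec (.of F)) (ht : ι ≫ OneBranch.planeToBase F = t)
    (n : χ ⟶ Υ) (hnt : n ≫ t = s) (hn : OneBranch.IsBirationalMorphism n)
    -- the line `L` with equation `l`
    (l : MvPolynomial (Fin 3) F) (hl : l.IsHomogeneous 1) (hl0 : l ≠ 0)
    -- `P` is the only geometric point of `L ∩ Υ`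
    (P : OneBranch.GeometricPoint t)
    (hP : ∀ q : OneBranch.GeometricPoint t, ι q.point ∈ OneBranch.zeroSet l ↔ q = P)
    -- `Pbar` is the only geometric point of `χ` over `P`
    (Pbar : OneBranch.GeometricPoint s)
    (hPbar : ∀ q : OneBranch.GeometricPoint s, q.1 ≫ n = P.1 ↔ q = Pbar)
    -- the affine curves `C = χ \ {Pbar}` and `Z = Υ \ {P}`
    (C : χ.Opens) (hC : (C : Set χ) = {Pbar.point}ᶜ)
    (Z : Υ.Opens) (hZ : (Z : Set Υ) = {P.point}ᶜ) :
    -- `n` maps `C` to `Z`, so that pulling back functions embeds `B = Γ(Υ, Z)` in `A = Γ(χ, C)`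
    ∃ h : C ≤ n ⁻¹ᵁ Z,
      Function.Injective (n.appLE Z C h) ∧
      Cardinal.lift.{u} (Cardinal.mk
        ↥(OneBranch.poleOrders s Pbar.point C Set.univ \
          OneBranch.poleOrders s Pbar.point C (Set.range (n.appLE Z C h)))) =
        OneBranch.quotientDim (OneBranch.baseToSections t Z) (n.appLE Z C h).hom ∧
      OneBranch.quotientDim (OneBranch.baseToSections t Z) (n.appLE Z C h).hom =
        Cardinal.sum (fun Q : {Q : Z // IsClosed ({Q} : Set Z)} => OneBranch.delta t Q.1.1) ∧
      OneBranch.quotientDim (OneBranch.baseToSections t Z) (n.appLE Z C h).hom <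
        Cardinal.aleph0 := by
  have : IsSeparated t := ht ▸ inferInstance
  have : LocallyOfFiniteType t := ht ▸ inferInstance
  have : JacobsonSpace Υ := LocallyOfFiniteType.jacobsonSpace t
  have : JacobsonSpace χ := LocallyOfFiniteType.jacobsonSpace s
  have : IsProper (n ≫ t) := hnt ▸ inferInstance
  have : IsProper n := IsProper.of_comp n t
  have : IsLocallyNoetherian χ := LocallyOfFiniteType.isLocallyNoetherian s
  have : CompactSpace χ := (quasiCompact_iff_compactSpace s).mp inferInstance
  have : IsNoetherian χ := {}
  have hPcl := OneBranch.isClosed_singleton_point t P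
  have hPbarcl := OneBranch.isClosed_singleton_point s Pbar
  have hnP : n Pbar.point = P.point := by
    have h := (hPbar Pbar).mpr rfl
    exact congrArg (fun f : Spec (.of (AlgebraicClosure F)) ⟶ Υ =>
      f (IsLocalRing.closedPoint (AlgebraicClosure F))) h
  -- Lying on the line depends only on the underlying point, so `hP` also excludes conjugates of
  -- `P`.
  have huP (q : OneBranch.GeometricPoint t) (hq : q.point = P.point) : q = P :=
    (hP q).mp (hq ▸ (hP P).mpr rfl)
  have huPbar (q : OneBranch.GeometricPoint s) (hq : n q.point = P.point) : q = Pbar := by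
    let q' : OneBranch.GeometricPoint t := ⟨q.1 ≫ n, by rw [Category.assoc, hnt, q.2]⟩
    exact (hPbar q).mp (congrArg Subtype.val (huP q' hq))
  -- the line meets the plane model only in `P`, so `Z` is affine
  have hW : ι ⁻¹' OneBranch.zeroSet l = {P.point} := by
    refine OneBranch.eq_singleton_of_closedPoints ?_ hPcl ((hP P).mpr rfl) fun y hy hycl => ?_
    · exact (OneBranch.isClosed_zeroSet l).preimage ι.continuous
    · obtain ⟨q, rfl⟩ := OneBranch.exists_geometricPoint t hycl
      exact congrArg _ ((hP q).mp hy)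
  have hZaff : IsAffineOpen Z :=
    OneBranch.isAffineOpen_of_eq_compl_preimage_zeroSet ι hl (hZ.trans (hW ▸ rfl))
  have hfib : n ⁻¹' {P.point} = {Pbar.point} := by
    refine OneBranch.eq_singleton_of_closedPoints (hPcl.preimage n.continuous) hPbarcl hnP
      fun x hx hxcl => ?_
    obtain ⟨q, rfl⟩ := OneBranch.exists_geometricPoint s hxcl
    exact congrArg _ (huPbar q hx)
  obtain rfl : C = n ⁻¹ᵁ Z := by
    refine SetLike.ext' ?_
    rw [hC, ← hfib]
    exact (congrArg (n ⁻¹' ·) hZ).symm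
  -- Otherwise the generic point of `χ` would lie in the fibre over `P`, hence be the closed point
  -- of `Pbar`.
  have hPη : P.point ≠ genericPoint Υ := by
    intro h
    have h1 : genericPoint χ ∈ n ⁻¹' {P.point} := hn.1.trans h.symm
    rw [hfib] at h1
    rw [← Set.mem_singleton_iff.mp h1] at hPbarcl
    exact OneBranch.not_isClosed_genericPoint hdim hPbarcl
  have hηΥ : ¬ IsClosed ({genericPoint Υ} : Set Υ) := fun h =>
    hPη ((genericPoint_specializes P.point).mem_closed h rfl)
  have hηZ : genericPoint Υ ∈ (Z : Set Υ) := hZ ▸ hPη.symm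
  have : Nonempty Z := ⟨⟨_, hηZ⟩⟩
  have : Nonempty (n ⁻¹ᵁ Z) := ⟨⟨genericPoint χ, show n (genericPoint χ) ∈ (Z : Set Υ) by
    rwa [hn.1]⟩⟩
  have : IsFinite n := hn.isFinite hdim hηΥ
  have hPbarη := (OneBranch.isClosed_singleton_iff_ne_genericPoint hdim).mp hPbarcl
  have := hreg Pbar.point
  have := OneBranch.isDiscreteValuationRing_stalk hdim hPbarη
  obtain ⟨h1, h2⟩ := hn.quotientDim_eq_sum_delta t hdim hreg hZaff
  refine ⟨le_rfl, hn.appLE_injective le_rfl, ?_, h2, h1⟩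
  refine OneBranch.lift_mk_poleOrders_diff s Pbar.point
    (OneBranch.coheight_eq_one hdim hPbarη) ?_ _ hC _ _
    (OneBranch.appLE_comp_baseToSections hnt le_rfl)
  -- The single branch makes `Pbar` rational over `F`.
  refine OneBranch.exists_sub_mem_maximalIdeal s hPbarcl fun q q' hq hq' => ?_
  rw [huPbar q (hq ▸ hnP), huPbar q' (hq' ▸ hnP)]
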